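/- A 3-uniform hypergraph $H$ consists of a finite vertex set $V(H)$ and a set $E(H)$ of 3-element subsets of $V(H)$, called edges. Let $\delta_1(H)$ denote the minimum, over all vertices $v\in V(H)$, of the number of edges of $H$ containing $v$. A $d$-matching in H is a set of $d$ pairwise disjoint edges of $H$. Given disjoint sets $V,W$ with $|V\cup W|=n$ and $|W|=d$, let $H_{n,d}(V,W)$ be the 3-uniform hypergraph on the vertex set $V\cup W$ whose edges are all 3-element subsets of $V\cup W$ that meet both $V$ and $W$ (that is, those with two vertices in $V$ and one in $W$, or one in $V$ and two in $W$). For $\varepsilon>0$, a 3-uniform hypergraph $H$ on $n$ vertices is called $\varepsilon$-close to $H_{n,d}$ if there is a partition $V,W$ of $V(H)$ with $|W|=d$ such that $$|E(H_{n,d}(V,W))\setminus E(H)|\le \varepsilon n^3 .$$ **Lemma 4.1.** There exist $\varepsilon>0$ and $n_0\in\mathbb N$ such that the following holds. Suppose that $H$ is a 3-uniform hypergraph on $n\ge n_0$ vertices and that $d\ge 0$ is an integer with $d\le n/3$. If $$\delta_1(H)>\binom{n-1}{2}-\binom{n-d}{2}$$ and $H$ is $\varepsilon$-close to $H_{n,d}$,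 then $H$ contains a $d$-matching. -/

import Mathlib

namespace Hypergraph

/-- Every edge of `H` has exactly three vertices. -/
def IsThreeUniform {α : Type*} (H : Hypergraph α) : Prop :=
  ∀ e ∈ H.edgeSet, e.ncard = 3

/-- The number of edges of a (finite) hypergraph that contain the vertex `v`. -/
noncomputable def vertexDegree {α : Type*} (H : Hypergraph α) (v : α) : ℕ :=
  {e | e ∈ H.edgeSet ∧ v ∈ e}.ncard

/-- The minimum vertex degree `δ₁(H)` of a finite hypergraph with at least one vertex. -/
noncomputable def minVertexDegree {α : Type*} (H : Hypergraph α) : ℕ :=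
  sInf (H.vertexDegree '' H.vertexSet)

/-- `e` is a triple `{x, y, z}` of distinct vertices with `x ∈ A`, `y ∈ B`, `z ∈ C`. -/
def IsTripleOfType {α : Type*} (A B C : Set α) (e : Set α) : Prop :=
  ∃ x ∈ A, ∃ y ∈ B, ∃ z ∈ C, x ≠ y ∧ x ≠ z ∧ y ≠ z ∧ e = {x, y, z}

/-- The hypergraph `H_{n,d}(V, W)`, where `n = |V ∪ W|` and `d = |W|`: its vertex set is `V ∪ W`
and its edges are all triples of type `VVW` or `VWW`. -/
def extremal {α : Type*} (V W : Set α) : Hypergraph α where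
  vertexSet := V ∪ W
  edgeSet := {e | IsTripleOfType V V W e ∨ IsTripleOfType V W W e}
  subset_vertexSet_of_mem_edgeSet' := by
    rintro e (⟨x, hx, y, hy, z, hz, -, -, -, rfl⟩ | ⟨x, hx, y, hy, z, hz, -, -, -, rfl⟩) <;>
    · rintro w (rfl | rfl | rfl) <;> simp_all

/-- `H` is `ε`-close to `H_{n,d}(V, W)`: at most `ε n³` edges of `H_{n,d}(V, W)` are missing
from `H`, where `n` is the number of vertices of `H`. -/
def IsCloseToExtremalOn {α : Type*} (H : Hypergraph α) (ε : ℝ) (V W : Set α) : Prop :=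
  (((extremal V W).edgeSet \ H.edgeSet).ncard : ℝ) ≤ ε * (H.vertexSet.ncard : ℝ) ^ 3

/-- `H` is `ε`-close to `H_{n,d}`: there is a partition `V, W` of the vertex set of `H` with
`|W| = d` such that `H` is `ε`-close to `H_{n,d}(V, W)`. A part may be empty. -/
def IsCloseToExtremal {α : Type*} (H : Hypergraph α) (ε : ℝ) (d : ℕ) : Prop :=
  ∃ V W : Set α, V ∪ W = H.vertexSet ∧ Disjoint V W ∧ W.ncard = d ∧
    H.IsCloseToExtremalOn ε V W

/-- `M` is a matching in `H`: a set of pairwise vertex-disjoint edges of `H`. -/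
def IsMatching {α : Type*} (H : Hypergraph α) (M : Set (Set α)) : Prop :=
  M ⊆ H.edgeSet ∧ ∀ e ∈ M, ∀ f ∈ M, e ≠ f → Disjoint e f

/-- `H` contains a `d`-matching, that is, a matching consisting of exactly `d` edges. -/
def HasMatchingOfSize {α : Type*} (H : Hypergraph α) (d : ℕ) : Prop :=
  ∃ M : Set (Set α), H.IsMatching M ∧ M.encard = d

end Hypergraph

/-! Call an ordered pair missing at a vertex if the two form a non-edge with it. The degree
hypothesis says that each vertex has fewer than (n - d)(n - d - 1) missing pairs. This bound passes
to any smaller vertex set with the same n - d.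

If n ≥ 100d, degrees alone suffice (`exists_matching_of_small`). Induct on d: without a d-matching,
each vertex is still avoided by a (d - 1)-matching, which all edges at that vertex must meet, so
degrees are O(dn). All edges meet the 3(d - 1) vertices of one such matching, so there are only
O(d²n) edges, too few for n vertices of degree of order dn.

If n ≤ 100d, call a vertex atypical if it lies in many missing VVW triples; closeness leaves few of
these. The danger is running out of W: after k edges are chosen, d - k vertices of W should remain.
Let BW be the atypical part of W. The small case inside V ∪ BW gives |BW| edges avoiding the typical
part G of W. Further edges, each with at most one vertex in G, cover the remaining atypical vertices
(`exists_matching_cover`). Among the typical vertices left, a few VWW triples correct the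
proportions, and a switching argument (`exists_perm_forall_mem`) finds VVW triples for the rest. -/

namespace Hypergraph

open Finset

/-- `M` is a set of pairwise disjoint triples from `F`, all contained in `X`. -/
structure IsTripleMatching {α : Type*} (F : Set (Finset α)) (X : Finset α)
    (M : Finset (Finset α)) : Prop where
  mem : ∀ e ∈ M, e ∈ F
  subset : ∀ e ∈ M, e ⊆ X
  card_eq : ∀ e ∈ M, e.card = 3
  disj : (M : Set (Finset α)).PairwiseDisjoint id

/-! ### Operations on matchings of triples -/

section
set_option linter.unusedSectionVars false
variable {α : Type*} [DecidableEq α] {F : Set (Finset α)} {X Y : Finset α}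
  {M N : Finset (Finset α)}

namespace IsTripleMatching

theorem empty : IsTripleMatching F X ∅ := by
  constructor <;> simp

theorem mono (h : IsTripleMatching F X M) (hXY : X ⊆ Y) : IsTripleMatching F Y M :=
  ⟨h.mem, fun e he => (h.subset e he).trans hXY, h.card_eq, h.disj⟩

theorem biUnion_subset (h : IsTripleMatching F X M) : M.biUnion id ⊆ X :=
  Finset.biUnion_subset.2 h.subset

theorem card_biUnion (h : IsTripleMatching F X M) : (M.biUnion id).card = 3 * M.card := by
  rw [Finset.card_biUnion (fun x hx y hy hxy => h.disj hx hy hxy), mul_comm,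
    ← smul_eq_mul, ← Finset.sum_const]
  exact Finset.sum_congr rfl h.card_eq

theorem disjoint_of_disjoint (hM : IsTripleMatching F X M) (hN : IsTripleMatching F Y N)
    (hXY : Disjoint X Y) : Disjoint M N := by
  rw [Finset.disjoint_left]
  intro e h1 h2
  have h3 : e ⊆ X ∩ Y := subset_inter (hM.subset e h1) (hN.subset e h2)
  rw [disjoint_iff_inter_eq_empty.1 hXY, subset_empty] at h3
  have := hM.card_eq e h1
  simp [h3] at this

theorem union (hM : IsTripleMatching F X M) (hN : IsTripleMatching F Y N)
    (hXY : Disjoint X Y) : IsTripleMatching F (X ∪ Y) (M ∪ N) where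
  mem e he := (mem_union.1 he).elim (hM.mem e) (hN.mem e)
  subset e he := (mem_union.1 he).elim (fun h => (hM.subset e h).trans subset_union_left)
    (fun h => (hN.subset e h).trans subset_union_right)
  card_eq e he := (mem_union.1 he).elim (hM.card_eq e) (hN.card_eq e)
  disj := by
    rw [coe_union, Set.pairwiseDisjoint_union]
    refine ⟨hM.disj, hN.disj, fun e he f hf _ => ?_⟩
    exact disjoint_of_subset_left (hM.subset e he) (disjoint_of_subset_right (hN.subset f hf) hXY)

theorem card_union_eq (hM : IsTripleMatching F X M) (hN : IsTripleMatching F Y N)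
    (hXY : Disjoint X Y) : (M ∪ N).card = M.card + N.card :=
  card_union_of_disjoint (hM.disjoint_of_disjoint hN hXY)

theorem singleton {e : Finset α} (he : e ∈ F) (hc : e.card = 3) : IsTripleMatching F e {e} := by
  constructor <;> simp [he, hc]

/-- With the ambient set cut down to the covered vertices, `union` only needs disjointness of the
vertices actually used. -/
theorem restrict (h : IsTripleMatching F X M) : IsTripleMatching F (M.biUnion id) M :=
  ⟨h.mem, fun _ he => subset_biUnion_of_mem id he, h.card_eq, h.disj⟩

/-- Adding one further triple to a matching. -/
theorem insert {e : Finset α} (h : IsTripleMatching F X M) (he : e ∈ F) (hc : e.card = 3)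
    (heX : e ⊆ X) (hd : Disjoint (M.biUnion id) e) :
    IsTripleMatching F X (insert e M) ∧ (insert e M).card = M.card + 1 := by
  have h1 := h.restrict.union (singleton he hc) hd
  have h2 := h.restrict.card_union_eq (singleton he hc) hd
  have h3 : M ∪ {e} = Insert.insert e M := by rw [union_comm]; rfl
  rw [h3] at h1 h2
  exact ⟨h1.mono (union_subset h.biUnion_subset heX), by simpa using h2⟩

end IsTripleMatching

/-! ### Links of vertices and small matchings -/

open scoped Classical in
/-- The ordered pairs which together with `v` form a triple from `F` inside `X`. -/
noncomputable def linkPairs (F : Set (Finset α)) (X : Finset α) (v : α) : Finset (α × α) :=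
  (X.erase v).offDiag.filter fun p => {v, p.1, p.2} ∈ F

open scoped Classical in
/-- The ordered pairs from `P` which together with `v` form a triple that is not in `F`. -/
noncomputable def missingIn (F : Set (Finset α)) (P : Finset (α × α)) (v : α) : Finset (α × α) :=
  P.filter fun p => {v, p.1, p.2} ∉ F

theorem mem_missingIn {P : Finset (α × α)} {v : α} {p : α × α} :
    p ∈ missingIn F P v ↔ p ∈ P ∧ {v, p.1, p.2} ∉ F := by
  simp [missingIn]

theorem missingIn_mono {P Q : Finset (α × α)} (h : P ⊆ Q) (v : α) :
    missingIn F P v ⊆ missingIn F Q v := by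
  classical
  exact filter_subset_filter _ h

/-- The ordered pairs which together with `v` form a triple in `X` that is not in `F`. -/
noncomputable def missingPairs (F : Set (Finset α)) (X : Finset α) (v : α) : Finset (α × α) :=
  missingIn F (X.erase v).offDiag v

theorem missingPairs_mono (h : X ⊆ Y) (v : α) : missingPairs F X v ⊆ missingPairs F Y v :=
  missingIn_mono (offDiag_mono (erase_subset_erase v h)) v

theorem card_linkPairs_add_card_missingPairs {v : α} (hv : v ∈ X) :
    (linkPairs F X v).card + (missingPairs F X v).card = (X.card - 1) * (X.card - 2) := by
  classical
  rw [linkPairs, missingPairs, missingIn, card_filter_add_card_filter_not, offDiag_card, card_erase_of_mem hv]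
  cases X.card with
  | zero => rfl
  | succ n => cases n <;> simp [Nat.mul_succ]

theorem card_triple {x y z : α} (hxy : x ≠ y) (hxz : x ≠ z) (hyz : y ≠ z) :
    ({x, y, z} : Finset α).card = 3 := card_eq_three.2 ⟨x, y, z, hxy, hxz, hyz, rfl⟩

/-- If no matching on `X` is larger than `M`, then few triples contain a vertex outside `M`. -/
theorem card_linkPairs_le_of_maximal {v : α} (hM : IsTripleMatching F (X.erase v) M) (hv : v ∈ X)
    (hmax : ∀ N, IsTripleMatching F X N → N.card ≠ M.card + 1) :
    (linkPairs F X v).card ≤ 6 * M.card * X.card := by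
  have hsub : linkPairs F X v ⊆ (M.biUnion id ×ˢ X) ∪ (X ×ˢ M.biUnion id) := by
    rintro ⟨x, y⟩ hxy
    simp only [linkPairs, mem_filter, mem_offDiag, mem_erase] at hxy
    obtain ⟨⟨⟨hxv, hx⟩, ⟨hyv, hy⟩, hne⟩, hF⟩ := hxy
    by_contra hcon
    simp only [mem_union, mem_product, hx, hy, and_true, true_and, not_or] at hcon
    obtain ⟨h1, h2⟩ := (hM.mono (erase_subset v X)).insert hF
      (card_triple hxv.symm hyv.symm hne) (by simp [insert_subset_iff, hv, hx, hy])
      (by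
        simp only [disjoint_insert_right, disjoint_singleton_right]
        exact ⟨fun h => by simpa using hM.biUnion_subset h, hcon.1, hcon.2⟩)
    exact hmax _ h1 h2
  refine (card_le_card hsub).trans ((card_union_le _ _).trans ?_)
  rw [card_product, card_product, hM.card_biUnion]
  exact le_of_eq (by ring)

-- Double counting of ordered triples: some coordinate lies in `S`, and moving it to the front gives
-- a triple counted from `S`. The three positions give the factor 3.
open scoped Classical in
theorem sum_card_linkPairs_le {S : Finset α}
    (hS : ∀ e ∈ F, e.card = 3 → e ⊆ X → (e ∩ S).Nonempty) :
    ∑ v ∈ X, (linkPairs F X v).card ≤ 3 * ∑ v ∈ S, (linkPairs F X v).card := by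
  set T : Finset (Σ _ : α, α × α) := X.sigma (fun v => linkPairs F X v)
  set TS : Finset (Σ _ : α, α × α) := S.sigma (fun v => linkPairs F X v)
  have h1 : T.card = ∑ v ∈ X, (linkPairs F X v).card := card_sigma _ _
  have h2 : TS.card = ∑ v ∈ S, (linkPairs F X v).card := card_sigma _ _
  rw [← h1, ← h2]
  have hsub : T ⊆ TS ∪ TS.image (fun p => ⟨p.2.1, p.1, p.2.2⟩) ∪
      TS.image (fun p => ⟨p.2.1, p.2.2, p.1⟩) := by
    rintro ⟨x, y, z⟩ h
    simp only [T, mem_sigma, linkPairs, mem_filter, mem_offDiag, mem_erase] at h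
    obtain ⟨hx, ⟨⟨hyx, hy⟩, ⟨hzx, hz⟩, hne⟩, hF⟩ := h
    have hyxz : ({y, x, z} : Finset α) = {x, y, z} := by ext; simp; tauto
    have hzxy : ({z, x, y} : Finset α) = {x, y, z} := by ext; simp; tauto
    obtain ⟨s, hs⟩ := hS _ hF (card_triple hyx.symm hzx.symm hne)
      (by simp [insert_subset_iff, hx, hy, hz])
    simp only [mem_inter, mem_insert, mem_singleton] at hs
    simp only [mem_union, mem_image]
    obtain ⟨rfl | rfl | rfl, hsS⟩ := hs
    · refine Or.inl (Or.inl (mem_sigma.2 ⟨hsS, ?_⟩))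
      simp only [linkPairs, mem_filter, mem_offDiag, mem_erase]; tauto
    · refine Or.inl (Or.inr ⟨⟨s, x, z⟩, mem_sigma.2 ⟨hsS, ?_⟩, rfl⟩)
      simp only [linkPairs, mem_filter, mem_offDiag, mem_erase, hyxz]; tauto
    · refine Or.inr ⟨⟨s, x, y⟩, mem_sigma.2 ⟨hsS, ?_⟩, rfl⟩
      simp only [linkPairs, mem_filter, mem_offDiag, mem_erase, hzxy]; tauto
  refine (card_le_card hsub).trans ((card_union_le _ _).trans ?_)
  have := card_union_le TS (TS.image (fun p => ⟨p.2.1, p.1, p.2.2⟩))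
  have := card_image_le (s := TS) (f := fun p => (⟨p.2.1, p.1, p.2.2⟩ : Σ _ : α, α × α))
  have := card_image_le (s := TS) (f := fun p => (⟨p.2.1, p.2.2, p.1⟩ : Σ _ : α, α × α))
  omega

/-- The Bollobás–Daykin–Erdős theorem for triples: the sharp minimum degree condition forces a
matching of size `d` if `d` is small compared with the number of vertices. -/
theorem exists_matching_of_small (F : Set (Finset α)) (d : ℕ) : ∀ X : Finset α,
    100 * d ≤ X.card →
    (∀ v ∈ X, (missingPairs F X v).card < (X.card - d) * (X.card - d - 1)) →
    ∃ M, IsTripleMatching F X M ∧ M.card = d := by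
  induction d with
  | zero => exact fun X _ _ => ⟨∅, .empty, rfl⟩
  | succ d ih =>
    intro X hX hdeg
    by_contra hcon
    push Not at hcon
    have step : ∀ v ∈ X, ∃ M, IsTripleMatching F (X.erase v) M ∧ M.card = d := by
      intro v hv
      apply ih
      · rw [card_erase_of_mem hv]; omega
      · intro u hu
        have h1 := hdeg u (mem_of_mem_erase hu)
        have h2 := card_le_card (missingPairs_mono (F := F) (erase_subset v X) u)
        -- Both |X| and the matching size drop by one, so the bound on missing pairs is the same.
        rw [card_erase_of_mem hv, show X.card - 1 - d = X.card - (d + 1) by omega]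
        omega
    have hub : ∀ v ∈ X, (linkPairs F X v).card ≤ 6 * d * X.card := by
      intro v hv
      obtain ⟨M, hM, rfl⟩ := step v hv
      exact card_linkPairs_le_of_maximal hM hv hcon
    obtain ⟨v₀, hv₀⟩ : X.Nonempty := card_pos.1 (by omega)
    obtain ⟨M, hM, hMc⟩ := step v₀ hv₀
    have hMX := hM.mono (erase_subset v₀ X)
    have hsum := sum_card_linkPairs_le (F := F) (X := X) (S := M.biUnion id)
      (fun e he hc heX => by
        by_contra hne
        rw [not_nonempty_iff_eq_empty, inter_comm, ← disjoint_iff_inter_eq_empty] at hne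
        obtain ⟨h1, h2⟩ := hMX.insert he hc heX hne
        exact hcon _ h1 (by rw [h2, hMc]))
    have hS : ∑ v ∈ M.biUnion id, (linkPairs F X v).card ≤ 3 * d * (6 * d * X.card) := by
      have := sum_le_card_nsmul (M.biUnion id) (fun v => (linkPairs F X v).card) _
        (fun v hv => hub v (hMX.biUnion_subset hv))
      rwa [hM.card_biUnion, hMc, smul_eq_mul] at this
    obtain ⟨n, hn⟩ : ∃ n, X.card = n + d + 2 := ⟨X.card - d - 2, by omega⟩
    -- Here d(2n + d + 1) = (n + d + 1)(n + d) - (n + 1)n. The extra 1 comes from the strict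
    -- inequality and is what settles d = 0.
    have hlow : ∀ v ∈ X, d * (2 * n + d + 1) + 1 ≤ (linkPairs F X v).card := by
      intro v hv
      have h1 := hdeg v hv
      have h2 := card_linkPairs_add_card_missingPairs (F := F) hv
      rw [hn, show n + d + 2 - 1 = n + d + 1 by omega, show n + d + 2 - 2 = n + d by omega] at h2
      rw [hn, show n + d + 2 - (d + 1) = n + 1 by omega, Nat.add_sub_cancel] at h1
      nlinarith
    have hlow' := card_nsmul_le_sum X (fun v => (linkPairs F X v).card) _ hlow
    rw [smul_eq_mul] at hlow'
    have hfin : X.card * (d * (2 * n + d + 1) + 1) ≤ X.card * (54 * d * d) := by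
      calc _ ≤ _ := hlow'
        _ ≤ _ := hsum
        _ ≤ 3 * (3 * d * (6 * d * X.card)) := Nat.mul_le_mul_left 3 hS
        _ = _ := by ring
    have := Nat.le_of_mul_le_mul_left hfin (by omega)
    nlinarith [Nat.zero_le (d * d)]

end
end Hypergraph

/-! ### Perfect matchings by switching, and greedy covering -/

namespace Hypergraph

open Finset

section
set_option linter.unusedSectionVars false
variable {α : Type*} [DecidableEq α] {F : Set (Finset α)}

open scoped Classical in
/-- Rearranging a partition into triples `{w k, v (k, false), v (k, true)}` such that all of them
lie in `F`, provided that every vertex is in few bad triples. -/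
theorem exists_perm_forall_mem {ι : Type*} [Fintype ι] {K : ℕ} (w : ι → α) (v : ι × Bool → α)
    (hW : ∀ i, (univ.filter fun p : (ι × Bool) × (ι × Bool) =>
      p.1 ≠ p.2 ∧ {w i, v p.1, v p.2} ∉ F).card ≤ K)
    (hV : ∀ p, (univ.filter fun q : (ι × Bool) × ι =>
      q.1 ≠ p ∧ {v p, v q.1, w q.2} ∉ F).card ≤ K)
    (hK : 3 * K < (Fintype.card ι - 1) * (Fintype.card ι - 2)) :
    ∃ (σ : Equiv.Perm (ι × Bool)) (τ : Equiv.Perm ι),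
      ∀ k, {w (τ k), v (σ (k, false)), v (σ (k, true))} ∈ F := by
  let good : Equiv.Perm (ι × Bool) × Equiv.Perm ι → Finset ι := fun s =>
    univ.filter fun k => {w (s.2 k), v (s.1 (k, false)), v (s.1 (k, true))} ∈ F
  -- Take an arrangement with the most triples in `F`; a bad index `z` will be repaired using two
  -- further indices.
  obtain ⟨⟨σ, τ⟩, hmax⟩ := Finite.exists_max fun s => (good s).card
  refine ⟨σ, τ, ?_⟩
  by_contra hcon
  push Not at hcon
  obtain ⟨z, hz⟩ := hcon
  set D := ((univ : Finset ι).erase z).offDiag with hD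
  have hDc : D.card = (Fintype.card ι - 1) * (Fintype.card ι - 2) := by
    rw [hD, offDiag_card, card_erase_of_mem (mem_univ z), card_univ]
    cases Fintype.card ι with
    | zero => rfl
    | succ n => cases n <;> simp [Nat.mul_succ]
  set A := D.filter fun p => {w (τ z), v (σ (p.1, false)), v (σ (p.2, false))} ∉ F with hA
  set B := D.filter fun p => {v (σ (z, false)), v (σ (p.1, true)), w (τ p.2)} ∉ F with hB
  set C := D.filter fun p => {v (σ (z, true)), v (σ (p.2, true)), w (τ p.1)} ∉ F with hC
  have hAc : A.card ≤ K := by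
    refine le_trans (card_le_card_of_injOn
      (fun p => (σ (p.1, false), σ (p.2, false))) ?_ ?_) (hW (τ z))
    · rintro ⟨x, y⟩ h
      simp only [hA, hD, coe_filter, mem_offDiag, Set.mem_ofPred_eq] at h
      simp [h.2, h.1.2.2]
    · rintro ⟨x, y⟩ _ ⟨x', y'⟩ _ h
      simpa using h
  have hBc : B.card ≤ K := by
    refine le_trans (card_le_card_of_injOn
      (fun p => (σ (p.1, true), τ p.2)) ?_ ?_) (hV (σ (z, false)))
    · rintro ⟨x, y⟩ h
      simp only [hB, hD, coe_filter, mem_offDiag, Set.mem_ofPred_eq] at h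
      simp [h.2]
    · rintro ⟨x, y⟩ _ ⟨x', y'⟩ _ h
      simpa using h
  have hCc : C.card ≤ K := by
    refine le_trans (card_le_card_of_injOn
      (fun p => (σ (p.2, true), τ p.1)) ?_ ?_) (hV (σ (z, true)))
    · rintro ⟨x, y⟩ h
      simp only [hC, hD, coe_filter, mem_offDiag, mem_erase, Set.mem_ofPred_eq] at h
      simp [h.2, h.1.2.1]
    · rintro ⟨x, y⟩ _ ⟨x', y'⟩ _ h
      simpa [and_comm] using h
  have hlt : (A ∪ B ∪ C).card < D.card := by
    have := card_union_le (A ∪ B) C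
    have := card_union_le A B
    omega
  obtain ⟨⟨i, j⟩, hij, hnot⟩ := exists_mem_notMem_of_card_lt_card hlt
  simp only [hA, hB, hC, mem_union, mem_filter, hij, true_and, not_or, not_not] at hnot
  obtain ⟨⟨h1, h2⟩, h3⟩ := hnot
  simp only [hD, mem_offDiag, mem_erase, mem_univ, and_true] at hij
  obtain ⟨hiz, hjz, hij⟩ := hij
  let σ' := σ * Equiv.swap (z, false) (i, false) * Equiv.swap (z, true) (j, false)
  let τ' := τ * Equiv.swap i j
  have hσ : ∀ p, σ' p = σ (Equiv.swap (z, false) (i, false)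
    (Equiv.swap (z, true) (j, false) p)) := fun _ => rfl
  have hτ : ∀ p, τ' p = τ (Equiv.swap i j p) := fun _ => rfl
  -- Only the triples at `z`, `i` and `j` change, and all three become good, contradicting
  -- maximality.
  have hsub : insert z (good (σ, τ)) ⊆ good (σ', τ') := by
    intro k hk
    simp only [good, mem_filter, mem_univ, true_and, mem_insert] at hk ⊢
    rw [hσ, hσ, hτ]
    by_cases hkz : k = z
    · subst hkz
      simpa [Equiv.swap_apply_def, hiz, hjz, hiz.symm, hjz.symm, hij, hij.symm] using h1
    by_cases hki : k = i
    · subst hki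
      simp only [Equiv.swap_apply_def, Prod.mk.injEq, hiz, hij, reduceCtorEq, and_false,
        and_true, if_true, if_false, and_self]
      convert h2 using 1
      ext; simp; tauto
    by_cases hkj : k = j
    · subst hkj
      simp only [Equiv.swap_apply_def, Prod.mk.injEq, hjz, hki, reduceCtorEq, and_false,
        and_true, if_true, if_false, and_self]
      convert h3 using 1
      ext; simp; tauto
    · simpa [Equiv.swap_apply_def, hkz, hki, hkj] using hk
  have hzn : z ∉ good (σ, τ) := by simpa [good] using hz
  have := card_le_card hsub
  rw [card_insert_of_notMem hzn] at this
  have := hmax (σ', τ')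
  omega

/-- If every vertex is in few missing triples of type `VVW`, then `V ∪ W` has a perfect matching
by such triples. -/
theorem exists_perfect_matching {V W : Finset α} {m K : ℕ} (hVW : Disjoint V W)
    (hVc : V.card = 2 * m) (hWc : W.card = m)
    (hW : ∀ w ∈ W, (missingIn F V.offDiag w).card ≤ K)
    (hV : ∀ v ∈ V, (missingIn F ((V.erase v) ×ˢ W) v).card ≤ K)
    (hK : 3 * K < (m - 1) * (m - 2)) :
    ∃ M, IsTripleMatching F (V ∪ W) M ∧ M.card = m := by
  have eW : Fin m ≃ W := (Fintype.equivFinOfCardEq (by simpa using hWc)).symm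
  have eV : Fin m × Bool ≃ V := Fintype.equivOfCardEq (by simp [hVc, mul_comm])
  have hne : ∀ i p, (eW i : α) ≠ eV p := fun i p h =>
    disjoint_left.1 hVW (eV p).2 (h ▸ (eW i).2)
  obtain ⟨σ, τ, h⟩ := exists_perm_forall_mem (F := F) (K := K) (fun i => (eW i : α))
    (fun p => (eV p : α))
    (fun i => by
      refine le_trans (card_le_card_of_injOn (fun p => ((eV p.1 : α), (eV p.2 : α))) ?_ ?_)
        (hW (eW i) (eW i).2)
      · rintro ⟨x, y⟩ h
        simp only [coe_filter, mem_univ, true_and, Set.mem_ofPred_eq] at h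
        simpa [mem_missingIn] using h
      · rintro ⟨x, y⟩ _ ⟨x', y'⟩ _ h
        simpa only [Prod.mk.injEq, SetLike.coe_eq_coe, EmbeddingLike.apply_eq_iff_eq] using h)
    (fun p => by
      refine le_trans (card_le_card_of_injOn (fun q => ((eV q.1 : α), (eW q.2 : α))) ?_ ?_)
        (hV (eV p) (eV p).2)
      · rintro ⟨x, y⟩ h
        simp only [coe_filter, mem_univ, true_and, Set.mem_ofPred_eq] at h
        simpa [mem_missingIn] using h
      · rintro ⟨x, y⟩ _ ⟨x', y'⟩ _ h
        simpa only [Prod.mk.injEq, SetLike.coe_eq_coe, EmbeddingLike.apply_eq_iff_eq] using h)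
    (by simpa using hK)
  set t : Fin m → Finset α :=
    fun k => {(eW (τ k) : α), (eV (σ (k, false)) : α), (eV (σ (k, true)) : α)} with ht
  have hVinj : ∀ p q, (eV (σ p) : α) = eV (σ q) ↔ p = q := by simp
  have hWinj : ∀ p q, (eW (τ p) : α) = eW (τ q) ↔ p = q := by simp
  have hdisj : ∀ k l, k ≠ l → Disjoint (t k) (t l) := by
    intro k l hkl
    simp only [ht, disjoint_insert_left, disjoint_singleton_left, mem_insert, mem_singleton,
      hVinj, hWinj, hne, fun i p => (hne i p).symm]
    simp [hkl]
  have hcard : ∀ k, (t k).card = 3 := fun k =>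
    card_triple (hne _ _) (hne _ _) (by rw [Ne, hVinj]; simp)
  have htinj : Function.Injective t := by
    intro k l hkl
    by_contra hne'
    have h1 := hdisj k l hne'
    have h2 := hcard k
    rw [hkl, disjoint_self] at h1
    simp [hkl, h1] at h2
  refine ⟨univ.image t, ⟨?_, ?_, ?_, ?_⟩, ?_⟩
  · simpa [ht] using h
  · simp only [mem_image, mem_univ, true_and, forall_exists_index, forall_apply_eq_imp_iff]
    intro k
    simp [ht, insert_subset_iff]
  · simpa using hcard
  · intro a ha b hb hab
    simp only [coe_image, coe_univ, Set.image_univ, Set.mem_range] at ha hb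
    obtain ⟨k, rfl⟩ := ha
    obtain ⟨l, rfl⟩ := hb
    exact hdisj k l fun h => hab (h ▸ rfl)
  · rw [card_image_of_injective _ htinj, card_univ, Fintype.card_fin]

/-- Greedily extending a matching so that it covers `B`; each new triple uses at most one vertex
from `G`. -/
theorem exists_matching_cover {X G : Finset α} {c b : ℕ} (B : Finset α) :
    ∀ M₀ : Finset (Finset α), IsTripleMatching F X M₀ →
    (M₀.biUnion id ∩ G).card + c ≤ M₀.card → M₀.card + B.card ≤ b →
    (∀ x ∈ B, ∀ S ⊆ X, S.card ≤ 3 * b → x ∉ S →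
      ∃ e ∈ F, x ∈ e ∧ e ⊆ X ∧ Disjoint S e ∧ e.card = 3 ∧ (e ∩ G).card ≤ 1) →
    ∃ M, IsTripleMatching F X M ∧ M₀ ⊆ M ∧ B ⊆ M.biUnion id ∧ (M.biUnion id ∩ G).card + c ≤ M.card ∧
      M.card ≤ b := by
  induction B using Finset.induction_on with
  | empty =>
    intro M hM hG hb _
    exact ⟨M, hM, Subset.rfl, empty_subset _, hG, by simpa using hb⟩
  | insert x B hx ih =>
    intro M₀ hM₀ hG₀ hb hext
    rw [card_insert_of_notMem hx] at hb
    obtain ⟨M, hM, hxM, hG, hMb, hsub⟩ : ∃ M, IsTripleMatching F X M ∧ x ∈ M.biUnion id ∧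
        (M.biUnion id ∩ G).card + c ≤ M.card ∧ M.card + B.card ≤ b ∧ M₀ ⊆ M := by
      by_cases hxM : x ∈ M₀.biUnion id
      · exact ⟨M₀, hM₀, hxM, hG₀, by omega, Subset.rfl⟩
      obtain ⟨e, heF, hxe, heX, hde, hce, hGe⟩ := hext x (mem_insert_self x B) (M₀.biUnion id)
        hM₀.biUnion_subset (by rw [hM₀.card_biUnion]; omega) hxM
      obtain ⟨h1, h2⟩ := hM₀.insert heF hce heX hde
      refine ⟨_, h1, ?_, ?_, by omega, subset_insert _ _⟩
      · rw [biUnion_insert]; exact mem_union_left _ hxe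
      · rw [biUnion_insert, union_inter_distrib_right, h2]
        have := card_union_le (id e ∩ G) (M₀.biUnion id ∩ G)
        simp only [id] at this ⊢
        omega
    obtain ⟨N, hN, hMN, hBN, hGN, hNb⟩ := ih M hM hG hMb
      fun y hy => hext y (mem_insert_of_mem hy)
    exact ⟨N, hN, hsub.trans hMN,
      insert_subset (biUnion_subset_biUnion_of_subset_left id hMN hxM) hBN, hGN, hNb⟩

end
end Hypergraph

/-! ### Greedy triples and completion among typical vertices -/

namespace Hypergraph

open Finset

section
set_option linter.unusedSectionVars false
variable {α : Type*} [DecidableEq α] {F : Set (Finset α)}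

/-- Few missing triples of type `VWW` allow a greedy choice of disjoint such triples. -/
theorem exists_matching_of_sum_missing_lt {V W : Finset α} {a T : ℕ} (hVW : Disjoint V W)
    (hT : ∑ v ∈ V, (missingIn F W.offDiag v).card ≤ T) (ha : T < a * (a * (a - 1))) (j : ℕ) :
    a + j ≤ V.card → a + 2 * j ≤ W.card →
    ∃ M, IsTripleMatching F (V ∪ W) M ∧ M.card = j ∧ (M.biUnion id ∩ V).card = j ∧
      (M.biUnion id ∩ W).card = 2 * j := by
  induction j with
  | zero => exact fun _ _ => ⟨∅, .empty, by simp⟩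
  | succ j ih =>
    intro hV hW
    obtain ⟨M, hM, hMc, hMV, hMW⟩ := ih (by omega) (by omega)
    set S := M.biUnion id with hS
    have hV' : a ≤ (V \ S).card := by rw [card_sdiff, hMV]; omega
    have hW' : a ≤ (W \ S).card := by rw [card_sdiff, hMW]; omega
    obtain ⟨v, hv, p, hp, hF⟩ : ∃ v ∈ V \ S, ∃ p ∈ (W \ S).offDiag, {v, p.1, p.2} ∈ F := by
      by_contra hcon
      push Not at hcon
      -- If no leftover triple is in `F`, each of at least `a` leftover vertices of `V` misses a(a -
      -- 1) pairs, exceeding `T` in total.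
      have h1 : ∀ v ∈ V \ S, a * (a - 1) ≤ (missingIn F W.offDiag v).card := by
        intro v hv
        have h2 : (W \ S).offDiag ⊆ missingIn F W.offDiag v := fun p hp =>
          mem_missingIn.2 ⟨offDiag_mono sdiff_subset hp, hcon v hv p hp⟩
        have h3 := card_le_card h2
        rw [offDiag_card, ← Nat.mul_sub_one] at h3
        exact (Nat.mul_le_mul hW' (Nat.sub_le_sub_right hW' 1)).trans h3
      have h4 := card_nsmul_le_sum (V \ S) _ _ h1
      have h5 := sum_le_sum_of_subset (f := fun v => (missingIn F W.offDiag v).card)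
        (sdiff_subset : V \ S ⊆ V)
      rw [smul_eq_mul] at h4
      have h6 := Nat.mul_le_mul_right (a * (a - 1)) hV'
      omega
    simp only [mem_offDiag, mem_sdiff] at hv hp
    have hvW : v ∉ W := disjoint_left.1 hVW hv.1
    have hp1 : p.1 ∉ V := disjoint_right.1 hVW hp.1.1
    have hp2 : p.2 ∉ V := disjoint_right.1 hVW hp.2.1.1
    have hd : Disjoint S {v, p.1, p.2} := by
      simp only [disjoint_insert_right, disjoint_singleton_right]
      exact ⟨hv.2, hp.1.2, hp.2.1.2⟩
    obtain ⟨h1, h2⟩ := hM.insert hF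
      (card_triple (fun h => hvW (h ▸ hp.1.1)) (fun h => hvW (h ▸ hp.2.1.1)) hp.2.2)
      (by simp [insert_subset_iff, hv.1, hp.1.1, hp.2.1.1]) hd
    refine ⟨_, h1, by rw [h2, hMc], ?_, ?_⟩
    · rw [biUnion_insert, id, ← hS, union_inter_distrib_right, card_union_of_disjoint
        (disjoint_of_subset_left inter_subset_left
          (disjoint_of_subset_right inter_subset_left hd.symm)), hMV]
      have : ({v, p.1, p.2} : Finset α) ∩ V = {v} := by
        ext x; simp only [mem_inter, mem_insert, mem_singleton]
        constructor
        · rintro ⟨rfl | rfl | rfl, h⟩ <;> simp_all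
        · rintro rfl; simp [hv.1]
      rw [this, card_singleton, add_comm]
    · rw [biUnion_insert, id, ← hS, union_inter_distrib_right, card_union_of_disjoint
        (disjoint_of_subset_left inter_subset_left
          (disjoint_of_subset_right inter_subset_left hd.symm)), hMW]
      have : ({v, p.1, p.2} : Finset α) ∩ W = {p.1, p.2} := by
        ext x; simp only [mem_inter, mem_insert, mem_singleton]
        constructor
        · rintro ⟨rfl | rfl | rfl, h⟩ <;> simp_all
        · rintro (rfl | rfl) <;> simp [hp.1.1, hp.2.1.1]
      rw [this, card_pair hp.2.2]
      ring

/-- Markov's inequality for a sum of natural numbers. -/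
theorem card_filter_lt_mul_le (A : Finset α) (f : α → ℕ) (K : ℕ) :
    (A.filter fun v => K < f v).card * (K + 1) ≤ ∑ v ∈ A, f v := by
  have h := card_nsmul_le_sum (A.filter fun v => K < f v) f (K + 1)
    (fun v hv => (mem_filter.1 hv).2)
  exact h.trans (sum_le_sum_of_subset (filter_subset _ _))

/-- A vertex missing few pairs lies in a triple that avoids `S` and meets `G` at most once. -/
theorem exists_triple_avoiding {X S G : Finset α} {x : α} {y : ℕ} (hxX : x ∈ X) (hxS : x ∉ S)
    (hxG : x ∉ G) (hy : y + S.card + 1 ≤ X.card)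
    (hlt : (missingPairs F X x).card + G.card * (G.card - 1) < y * (y - 1)) :
    ∃ e ∈ F, x ∈ e ∧ e ⊆ X ∧ Disjoint S e ∧ e.card = 3 ∧ (e ∩ G).card ≤ 1 := by
  set Y := (X.erase x) \ S with hY
  have hYc : y ≤ Y.card := by
    have := le_card_sdiff S (X.erase x)
    rw [card_erase_of_mem hxX, ← hY] at this
    omega
  -- Pairs inside `G` are excluded along with the missing ones; since `x` is not in `G`, any other
  -- pair gives at most one vertex in `G`.
  have hlt' : (missingPairs F X x ∪ G.offDiag).card < Y.offDiag.card := by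
    refine (card_union_le _ _).trans_lt ?_
    rw [offDiag_card, offDiag_card, ← Nat.mul_sub_one, ← Nat.mul_sub_one]
    exact hlt.trans_le (Nat.mul_le_mul hYc (Nat.sub_le_sub_right hYc 1))
  obtain ⟨p, hp, hn⟩ := exists_mem_notMem_of_card_lt_card hlt'
  have hp' : p ∈ (X.erase x).offDiag := offDiag_mono sdiff_subset hp
  simp only [missingPairs, mem_union, mem_missingIn, hp', true_and, not_or, not_not] at hn
  simp only [hY, mem_offDiag, mem_sdiff, mem_erase] at hp
  obtain ⟨⟨⟨h1x, h1X⟩, h1S⟩, ⟨⟨h2x, h2X⟩, h2S⟩, hne⟩ := hp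
  refine ⟨_, hn.1, by simp, by simp [insert_subset_iff, *], by simp [*],
    card_triple h1x.symm h2x.symm hne, ?_⟩
  have hG := hn.2
  simp only [mem_offDiag, not_and, not_not] at hG
  rw [card_le_one]
  intro a ha b hb
  simp only [mem_inter, mem_insert, mem_singleton] at ha hb
  obtain ⟨rfl | rfl | rfl, haG⟩ := ha <;> obtain ⟨rfl | rfl | rfl, hbG⟩ := hb <;> simp_all

/-- Completing a near-extremal hypergraph all of whose vertices are typical: if `W` has at least
`m` vertices and `V ∪ W` at least `3 * m`, there is a matching of size `m`. -/
theorem exists_matching_of_typical {V W : Finset α} {m a K T : ℕ} (hVW : Disjoint V W)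
    (hWm : m ≤ W.card) (hm : 3 * m ≤ V.card + W.card)
    (hW : ∀ w ∈ W, (missingIn F V.offDiag w).card ≤ K)
    (hV : ∀ v ∈ V, (missingIn F ((V.erase v) ×ˢ W) v).card ≤ K)
    (hT : ∑ v ∈ V, (missingIn F W.offDiag v).card ≤ T) (ha : T < a * (a * (a - 1)))
    (haV : a + (2 * m - V.card) ≤ V.card) (haW : a + 2 * (2 * m - V.card) ≤ W.card)
    (ham : a + (2 * m - V.card) ≤ m) (hK : 3 * K < (a - 1) * (a - 2)) :
    ∃ M, IsTripleMatching F (V ∪ W) M ∧ M.card = m := by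
  -- With j triples VWW, the other m - j triples VVW need |V| - j ≥ 2(m - j), so j = 2m - |V| is the
  -- least choice. Truncation gives j = 0 when `V` is large enough.
  obtain ⟨M, hM, hMc, hMV, hMW⟩ := exists_matching_of_sum_missing_lt hVW hT ha _ haV haW
  set j := 2 * m - V.card with hj
  set S := M.biUnion id with hS
  obtain ⟨V', hV'sub, hV'c⟩ := exists_subset_card_eq (s := V \ S) (n := 2 * (m - j))
    (by rw [card_sdiff, hMV]; omega)
  obtain ⟨W', hW'sub, hW'c⟩ := exists_subset_card_eq (s := W \ S) (n := m - j)
    (by rw [card_sdiff, hMW]; omega)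
  have hV'V := hV'sub.trans sdiff_subset
  have hW'W := hW'sub.trans sdiff_subset
  obtain ⟨N, hN, hNc⟩ := exists_perfect_matching (F := F) (K := K)
    (disjoint_of_subset_left hV'V (disjoint_of_subset_right hW'W hVW)) hV'c hW'c
    (fun w hw => (card_le_card (missingIn_mono (offDiag_mono hV'V) w)).trans (hW w (hW'W hw)))
    (fun v hv => (card_le_card (missingIn_mono
      (product_subset_product (erase_subset_erase v hV'V) hW'W) v)).trans (hV v (hV'V hv)))
    (hK.trans_le (Nat.mul_le_mul (by omega) (by omega)))
  have hd : Disjoint S (V' ∪ W') := disjoint_union_right.2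
    ⟨disjoint_of_subset_right hV'sub disjoint_sdiff,
      disjoint_of_subset_right hW'sub disjoint_sdiff⟩
  refine ⟨M ∪ N, (hM.restrict.union hN hd).mono (union_subset hM.biUnion_subset
    (union_subset_union hV'V hW'W)), ?_⟩
  rw [hM.restrict.card_union_eq hN hd, hMc, hNc]
  omega

end
end Hypergraph

/-! ### Matchings of linear size -/

namespace Hypergraph

open Finset

section
set_option linter.unusedSectionVars false
variable {α : Type*} [DecidableEq α] {F : Set (Finset α)}

/-- If few pairs are missing in total, few vertices miss more than `n ^ 2 / 10 ^ 6` pairs. -/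
theorem card_atypical_le {A : Finset α} {f : α → ℕ} {n : ℕ} (hn : 0 < n)
    (h : 10 ^ 12 * ∑ v ∈ A, f v ≤ 27 * n ^ 3) :
    10 ^ 6 * (A.filter fun v => n ^ 2 / 10 ^ 6 < f v).card ≤ 27 * n := by
  have h1 := card_filter_lt_mul_le A f (n ^ 2 / 10 ^ 6)
  set b := (A.filter fun v => n ^ 2 / 10 ^ 6 < f v).card
  have h2 : n ^ 2 ≤ 10 ^ 6 * (n ^ 2 / 10 ^ 6 + 1) := by omega
  have h3 : (10 ^ 6 * b) * n ^ 2 ≤ 27 * n * n ^ 2 := by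
    calc (10 ^ 6 * b) * n ^ 2 ≤ (10 ^ 6 * b) * (10 ^ 6 * (n ^ 2 / 10 ^ 6 + 1)) :=
          Nat.mul_le_mul_left _ h2
      _ = 10 ^ 12 * (b * (n ^ 2 / 10 ^ 6 + 1)) := by ring
      _ ≤ 10 ^ 12 * ∑ v ∈ A, f v := Nat.mul_le_mul_left _ h1
      _ ≤ 27 * n ^ 3 := h
      _ = _ := by ring
  exact Nat.le_of_mul_le_mul_right h3 (by positivity)

/-- The count needed for `exists_triple_avoiding` while covering: (n - d)² + d² falls short of n² by
2d(n - d), at least n²/75 for linear d, whereas the 3b vertices in use cost only about 6bn. -/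
theorem sq_pairs_lt {n d b g q : ℕ} (hn : 1000 ≤ n) (hd : 3 * d ≤ n) (hd' : n ≤ 100 * d)
    (hb : 5000 * b ≤ n) (hg : g ≤ d) (hq : q < (n - d) * (n - d - 1)) :
    q + g * (g - 1) < (n - 3 * b - 1) * (n - 3 * b - 1 - 1) := by
  have h1 : g * (g - 1) ≤ d * (d - 1) := Nat.mul_le_mul hg (by omega)
  have h2 : (n - d) * (n - d - 1) + d * (d - 1) ≤ (n - 3 * b - 1) * (n - 3 * b - 1 - 1) := by
    obtain ⟨e, rfl⟩ : ∃ e, n = d + e + 2 := ⟨n - d - 2, by omega⟩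
    obtain ⟨d, rfl⟩ : ∃ d', d = d' + 1 := ⟨d - 1, by omega⟩
    obtain ⟨y, hy⟩ : ∃ y, d + 1 + e + 2 = y + 3 * b + 2 := ⟨d + 1 + e + 2 - 3 * b - 2, by omega⟩
    rw [show d + 1 + e + 2 - (d + 1) = e + 2 by omega, hy,
      show y + 3 * b + 2 - 3 * b - 1 = y + 1 by omega]
    simp only [show e + 2 - 1 = e + 1 by omega, Nat.add_sub_cancel]
    have hyz : (y : ℤ) = d + e + 1 - 3 * b := by omega
    zify
    rw [hyz]
    have hb0 : (0 : ℤ) ≤ b := by positivity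
    have hb1 : 5000 * (b : ℤ) ≤ d + e + 3 := by omega
    have hd1 : (d : ℤ) + e + 3 ≤ 100 * (d + 1) := by omega
    have hd2 : 3 * ((d : ℤ) + 1) ≤ d + e + 3 := by omega
    have hn1 : (1000 : ℤ) ≤ d + e + 3 := by omega
    have hb2 : 5000 * ((b : ℤ) * (d + e + 3)) ≤ (d + e + 3) * (d + e + 3) := by nlinarith
    have hde : (d + e + 3 : ℤ) * (2 * (d + e + 3)) ≤ (100 * (d + 1)) * (3 * (e + 2)) :=
      mul_le_mul hd1 (by linarith) (by positivity) (by positivity)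
    nlinarith [mul_self_nonneg (b : ℤ)]
  omega

set_option maxHeartbeats 2000000 in
/-- The near-extremal case when the matching size is linear in the number of vertices. -/
theorem exists_matching_of_close {V W : Finset α} {n d : ℕ} (hVW : Disjoint V W)
    (hn : (V ∪ W).card = n) (hn₀ : 10 ^ 6 ≤ n) (hWd : W.card = d) (hd : 3 * d ≤ n)
    (hd' : n ≤ 100 * d)
    (hdeg : ∀ v ∈ V ∪ W, (missingPairs F (V ∪ W) v).card < (n - d) * (n - d - 1))
    (hVVW : 10 ^ 12 * ∑ v ∈ V, (missingIn F ((V.erase v) ×ˢ W) v).card ≤ 27 * n ^ 3)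
    (hWVV : 10 ^ 12 * ∑ w ∈ W, (missingIn F V.offDiag w).card ≤ 27 * n ^ 3)
    (hVWW : 10 ^ 12 * ∑ v ∈ V, (missingIn F W.offDiag v).card ≤ 27 * n ^ 3) :
    ∃ M, IsTripleMatching F (V ∪ W) M ∧ M.card = d := by
  have hVc : V.card + d = n := by rw [← hn, card_union_of_disjoint hVW, hWd]
  have hBVc := card_atypical_le (by omega) hVVW
  have hBWc := card_atypical_le (by omega) hWVV
  set K := n ^ 2 / 10 ^ 6 with hK
  set BV := V.filter fun v => K < (missingIn F ((V.erase v) ×ˢ W) v).card with hBV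
  set BW := W.filter fun w => K < (missingIn F V.offDiag w).card with hBW
  have hBWW : BW ⊆ W := filter_subset _ _
  have hBVV : BV ⊆ V := filter_subset _ _
  set G := W \ BW with hG
  have hGc : G.card + BW.card = d := by rw [hG, card_sdiff_add_card_eq_card hBWW, hWd]
  -- Bounds the edges used for covering: |BW| initial ones and at most one per atypical vertex.
  set b := BW.card + (BV ∪ BW).card with hb
  have hbn : 5000 * b ≤ n := by
    have := card_union_le BV BW
    omega
  -- A matching avoiding the typical vertices of `W`.
  have hXc : (V ∪ BW).card = n - d + BW.card := by
    rw [card_union_of_disjoint (disjoint_of_subset_right hBWW hVW)]; omega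
  obtain ⟨M₀, hM₀, hM₀c⟩ := exists_matching_of_small F BW.card (V ∪ BW) (by omega) (by
    intro v hv
    have hsub : V ∪ BW ⊆ V ∪ W := union_subset_union_right hBWW
    -- Since |V ∪ BW| - |BW| = n - d, the degree bound is exactly the one required here.
    rw [hXc, Nat.add_sub_cancel]
    exact (card_le_card (missingPairs_mono hsub v)).trans_lt (hdeg v (hsub hv)))
  have hM₀G : M₀.biUnion id ∩ G = ∅ := by
    rw [← disjoint_iff_inter_eq_empty]
    refine disjoint_of_subset_left hM₀.biUnion_subset (disjoint_union_left.2 ⟨?_, ?_⟩)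
    · exact disjoint_of_subset_right sdiff_subset hVW
    · exact disjoint_sdiff
  -- Covering all atypical vertices.
  obtain ⟨M₁, hM₁, -, hBM, hM₁G, hM₁b⟩ := exists_matching_cover (F := F) (X := V ∪ W) (G := G)
    (c := BW.card) (b := b) (BV ∪ BW) M₀
    (hM₀.mono (union_subset_union_right hBWW)) (by simp [hM₀G, hM₀c]) (by omega) (by
      intro x hx S hS hSb hxS
      have hxX : x ∈ V ∪ W := union_subset_union hBVV hBWW hx
      have hxG : x ∉ G := by
        rcases mem_union.1 hx with hx | hx
        · exact fun h => disjoint_left.1 hVW (hBVV hx) (mem_sdiff.1 h).1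
        · exact fun h => (mem_sdiff.1 h).2 hx
      exact exists_triple_avoiding (y := n - 3 * b - 1) hxX hxS hxG (by omega)
        (sq_pairs_lt (by omega) hd hd' hbn (by omega) (hdeg x hxX)))
  set S := M₁.biUnion id with hS
  have hSc : S.card = 3 * M₁.card := hM₁.card_biUnion
  have hV₂ : n ≤ (V \ S).card + d + 3 * M₁.card := by
    have := le_card_sdiff S V; omega
  -- The |BW| units of slack kept by the covering offset the loss of `BW` from `W`.
  have hW₂ : d ≤ (W \ S).card + M₁.card := by
    have h1 : G \ S ⊆ W \ S := sdiff_subset_sdiff sdiff_subset Subset.rfl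
    have h2 := card_le_card h1
    rw [card_sdiff] at h2
    omega
  have hVW₂ : (V \ S).card + (W \ S).card + 3 * M₁.card = n := by
    rw [← card_union_of_disjoint (disjoint_of_subset_left sdiff_subset
      (disjoint_of_subset_right sdiff_subset hVW)), ← union_sdiff_distrib, ← hSc,
      card_sdiff_add_card_eq_card hM₁.biUnion_subset, hn]
  -- The remaining vertices are typical.
  have hn200 : n < 200 * (n / 200) + 200 := by omega
  obtain ⟨M₂, hM₂, hM₂c⟩ := exists_matching_of_typical (F := F) (V := V \ S) (W := W \ S)
    (m := d - M₁.card) (a := n / 200) (K := K) (T := 27 * n ^ 3 / 10 ^ 12)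
    (disjoint_of_subset_left sdiff_subset (disjoint_of_subset_right sdiff_subset hVW))
    (by omega) (by omega)
    (fun w hw => by
      refine (card_le_card (missingIn_mono (offDiag_mono sdiff_subset) w)).trans ?_
      by_contra hcon
      exact (mem_sdiff.1 hw).2 (hBM (mem_union_right _
        (mem_filter.2 ⟨(mem_sdiff.1 hw).1, not_le.1 hcon⟩))))
    (fun v hv => by
      refine (card_le_card (missingIn_mono (product_subset_product
        (erase_subset_erase v sdiff_subset) sdiff_subset) v)).trans ?_
      by_contra hcon
      exact (mem_sdiff.1 hv).2 (hBM (mem_union_left _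
        (mem_filter.2 ⟨(mem_sdiff.1 hv).1, not_le.1 hcon⟩))))
    (by
      have h1 : ∑ v ∈ V \ S, (missingIn F (W \ S).offDiag v).card ≤
          ∑ v ∈ V, (missingIn F W.offDiag v).card :=
        (sum_le_sum fun v _ => card_le_card (missingIn_mono (offDiag_mono sdiff_subset) v)).trans
          (sum_le_sum_of_subset sdiff_subset)
      refine h1.trans ((Nat.le_div_iff_mul_le (by norm_num)).2 ?_)
      rwa [mul_comm])
    (by
      rw [Nat.div_lt_iff_lt_mul (by norm_num)]
      obtain ⟨a, ha⟩ : ∃ a, n / 200 = a + 1 := ⟨n / 200 - 1, by omega⟩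
      rw [ha, Nat.add_sub_cancel]
      have h1 : n ≤ 400 * a := by omega
      have h2 : n ^ 3 ≤ (400 * a) ^ 3 := Nat.pow_le_pow_left h1 3
      have h3 : 0 < a ^ 3 := by have : 0 < a := by omega
                                positivity
      nlinarith [Nat.zero_le (a ^ 2)])
    -- The deficit 2(d - |M₁|) - |V \ S| is at most 3d - n + |M₁| ≤ |M₁| ≤ b, which is tiny; as d ≥
    -- n/100, there is room for a = n/200.
    (by omega) (by omega) (by omega)
    (by
      obtain ⟨a, ha⟩ : ∃ a, n / 200 = a + 2 := ⟨n / 200 - 2, by omega⟩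
      rw [ha, Nat.add_sub_cancel, show a + 2 - 1 = a + 1 by omega]
      have h1 : n ≤ 400 * a := by omega
      have h2 : n ^ 2 ≤ (400 * a) ^ 2 := Nat.pow_le_pow_left h1 2
      have h3 : 10 ^ 6 * K ≤ n ^ 2 := Nat.mul_div_le _ _
      have h4 : 0 < a := by omega
      nlinarith)
  have hdisj : Disjoint S ((V \ S) ∪ (W \ S)) :=
    disjoint_union_right.2 ⟨disjoint_sdiff, disjoint_sdiff⟩
  refine ⟨M₁ ∪ M₂, (hM₁.restrict.union hM₂ hdisj).mono (union_subset hM₁.biUnion_subset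
    (union_subset_union sdiff_subset sdiff_subset)), ?_⟩
  rw [hM₁.restrict.card_union_eq hM₂ hdisj, hM₂c]
  omega

end
end Hypergraph

/-! ### Passing from the hypergraph to counts of missing pairs -/

namespace Hypergraph

open Finset

section
set_option linter.unusedSectionVars false
variable {α : Type*} [DecidableEq α]

/-- The edges of `H` that are finite sets, as a set of finsets. -/
def finsetEdges (H : Hypergraph α) : Set (Finset α) := {e | (e : Set α) ∈ H.edgeSet}

open scoped Classical in
theorem vertexDegree_le_card_filter {H : Hypergraph α} {X : Finset α} (hH : H.IsThreeUniform)
    (hX : (X : Set α) = H.vertexSet) (v : α) :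
    H.vertexDegree v ≤
      (((powersetCard 3 X).filter fun e => v ∈ e).filter fun e => e ∈ H.finsetEdges).card := by
  set T := ((powersetCard 3 X).filter fun e => v ∈ e).filter fun e => e ∈ H.finsetEdges with hT
  have hsub : {e | e ∈ H.edgeSet ∧ v ∈ e} ⊆ ((T.image fun e : Finset α => (e : Set α)) : Set (Set α)) := by
    rintro e ⟨he, hve⟩
    have heX : e ⊆ (X : Set α) := hX ▸ H.subset_vertexSet_of_mem_edgeSet' he
    obtain ⟨f, rfl⟩ := (X.finite_toSet.subset heX).exists_finset_coe
    have hc := hH _ he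
    rw [Set.ncard_coe_finset] at hc
    simp only [coe_image, Set.mem_image, mem_coe]
    exact ⟨f, mem_filter.2 ⟨mem_filter.2 ⟨mem_powersetCard.2 ⟨coe_subset.1 heX, hc⟩, hve⟩, he⟩,
      rfl⟩
  refine (Set.ncard_le_ncard hsub (finite_toSet _)).trans ?_
  rw [Set.ncard_coe_finset]
  exact card_image_le

theorem card_filter_mem_powersetCard_three {X : Finset α} {v : α} (hv : v ∈ X) :
    ((powersetCard 3 X).filter fun e => v ∈ e).card = (X.card - 1).choose 2 := by
  rw [← card_erase_of_mem hv, ← card_powersetCard]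
  refine card_bij' (fun e _ => e.erase v) (fun e _ => insert v e) ?_ ?_ ?_ ?_
  · intro e he
    simp only [mem_filter, mem_powersetCard] at he ⊢
    exact ⟨erase_subset_erase v he.1.1, by rw [card_erase_of_mem he.2, he.1.2]⟩
  · intro e he
    simp only [mem_filter, mem_powersetCard] at he ⊢
    have hve : v ∉ e := fun h => by simpa using he.1 h
    exact ⟨⟨insert_subset hv (he.1.trans (erase_subset _ _)),
      by rw [card_insert_of_notMem hve, he.2]⟩, mem_insert_self _ _⟩
  · intro e he
    exact insert_erase (mem_filter.1 he).2
  · intro e he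
    simp only [mem_powersetCard] at he
    exact erase_insert fun h => by simpa using he.1 h

open scoped Classical in
theorem card_missingPairs_le (F : Set (Finset α)) {X : Finset α} {v : α} (hv : v ∈ X) :
    (missingPairs F X v).card ≤
      2 * (((powersetCard 3 X).filter fun e => v ∈ e).filter fun e => e ∉ F).card := by
  refine card_le_mul_card_image_of_maps_to (f := fun p => {v, p.1, p.2}) ?_ 2 ?_
  · rintro ⟨x, y⟩ h
    simp only [missingPairs, mem_missingIn, mem_offDiag, mem_erase] at h
    obtain ⟨⟨⟨hxv, hx⟩, ⟨hyv, hy⟩, hne⟩, hF⟩ := h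
    simp only [mem_filter, mem_powersetCard]
    exact ⟨⟨⟨by simp [insert_subset_iff, *], card_triple hxv.symm hyv.symm hne⟩, by simp⟩, hF⟩
  · intro e he
    simp only [mem_filter, mem_powersetCard] at he
    have hsub : ((missingPairs F X v).filter fun p => {v, p.1, p.2} = e) ⊆ (e.erase v).offDiag := by
      rintro ⟨x, y⟩ h
      simp only [missingPairs, mem_filter, mem_missingIn, mem_offDiag, mem_erase] at h ⊢
      obtain ⟨⟨⟨⟨hxv, hx⟩, ⟨hyv, hy⟩, hne⟩, hF⟩, rfl⟩ := h
      simp [*]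
    refine (card_le_card hsub).trans ?_
    rw [offDiag_card, card_erase_of_mem he.1.2, he.1.1.2]

/-- Fewer than C(n - d, 2) triples at `v` are non-edges, and each accounts for at most two ordered
pairs. -/
theorem card_missingPairs_lt {H : Hypergraph α} {X : Finset α} {d : ℕ} (hH : H.IsThreeUniform)
    (hX : (X : Set α) = H.vertexSet)
    (hdeg : ((X.card - 1).choose 2 : ℤ) - ((X.card - d).choose 2 : ℤ) < (H.minVertexDegree : ℤ))
    {v : α} (hv : v ∈ X) :
    (missingPairs H.finsetEdges X v).card < (X.card - d) * (X.card - d - 1) := by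
  classical
  have h1 : H.minVertexDegree ≤ H.vertexDegree v :=
    Nat.sInf_le ⟨v, by rw [← hX]; exact hv, rfl⟩
  have h2 := vertexDegree_le_card_filter hH hX v
  have h3 := card_missingPairs_le H.finsetEdges hv
  have h4 := card_filter_add_card_filter_not (s := (powersetCard 3 X).filter fun e => v ∈ e)
    (fun e => e ∈ H.finsetEdges)
  rw [card_filter_mem_powersetCard_three hv] at h4
  have h5 : 2 * (X.card - d).choose 2 = (X.card - d) * (X.card - d - 1) := by
    rw [Nat.choose_two_right, Nat.mul_div_cancel' (Nat.even_mul_pred_self _).two_dvd]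
  omega

/-- A triple e in `Z` is counted only through elements of e × e × e, hence the crude factor 27. -/
theorem sum_card_missingIn_le {F : Set (Finset α)} {A : Finset α} {P : α → Finset (α × α)}
    {Z : Finset (Finset α)} (hZ : ∀ e ∈ Z, e.card = 3)
    (hP : ∀ v ∈ A, ∀ p ∈ P v, {v, p.1, p.2} ∉ F → {v, p.1, p.2} ∈ Z) :
    ∑ v ∈ A, (missingIn F (P v) v).card ≤ 27 * Z.card := by
  rw [← card_sigma]
  refine card_le_mul_card_image_of_maps_to (f := fun q => {q.1, q.2.1, q.2.2}) ?_ 27 ?_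
  · rintro ⟨v, p⟩ h
    obtain ⟨hv, hp⟩ := mem_sigma.1 h
    obtain ⟨hp, hF⟩ := mem_missingIn.1 hp
    exact hP v hv p hp hF
  · intro e he
    have hsub : ((A.sigma fun v => missingIn F (P v) v).filter
        fun q => {q.1, q.2.1, q.2.2} = e) ⊆ e.sigma fun _ => e ×ˢ e := by
      rintro ⟨v, p⟩ h
      obtain ⟨-, rfl⟩ := mem_filter.1 h
      simp
    refine (card_le_card hsub).trans ?_
    simp [card_sigma, hZ e he]

open scoped Classical in
theorem card_filter_missing_le {H : Hypergraph α} {V W : Set α} (X : Finset α)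
    (hfin : (V ∪ W).Finite) :
    ((powersetCard 3 X).filter fun e : Finset α =>
      (e : Set α) ∈ (extremal V W).edgeSet \ H.edgeSet).card ≤
      ((extremal V W).edgeSet \ H.edgeSet).ncard := by
  rw [← card_image_of_injective _ (coe_injective (α := α)), ← Set.ncard_coe_finset]
  -- Finiteness matters: `Set.ncard` of an infinite set is 0.
  refine Set.ncard_le_ncard ?_ (hfin.finite_subsets.subset fun e he =>
    (extremal V W).subset_vertexSet_of_mem_edgeSet' he.1)
  intro e he
  simp only [coe_image, Set.mem_image, mem_coe, mem_filter] at he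
  obtain ⟨f, hf, rfl⟩ := he
  exact hf.2

theorem IsTripleMatching.hasMatchingOfSize {H : Hypergraph α} {X : Finset α}
    {M : Finset (Finset α)} (hM : IsTripleMatching H.finsetEdges X M) :
    H.HasMatchingOfSize M.card := by
  refine ⟨(fun e : Finset α => (e : Set α)) '' M, ⟨?_, ?_⟩, ?_⟩
  · rintro _ ⟨e, he, rfl⟩
    exact hM.mem e he
  · rintro _ ⟨e, he, rfl⟩ _ ⟨f, hf, rfl⟩ hne
    exact disjoint_coe.2 (hM.disj he hf fun h => hne (by rw [h]))
  · rw [(coe_injective (α := α)).encard_image, Set.encard_coe_eq_coe_finsetCard]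

end

theorem hasMatchingOfSize_of_isCloseToExtremal {α : Type*} (H : Hypergraph α) {n d : ℕ}
    (hH : H.IsThreeUniform) (hfin : H.vertexSet.Finite) (hn : H.vertexSet.ncard = n)
    (hn₀ : 10 ^ 6 ≤ n) (hd : 3 * d ≤ n)
    (hdeg : ((n - 1).choose 2 : ℤ) - ((n - d).choose 2 : ℤ) < (H.minVertexDegree : ℤ))
    (hclose : H.IsCloseToExtremal (1 / 10 ^ 12) d) : H.HasMatchingOfSize d := by
  classical
  obtain ⟨V, W, hVWX, hVW, hWd, hmiss⟩ := hclose
  rw [IsCloseToExtremalOn, hn] at hmiss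
  have hVWfin : (V ∪ W).Finite := hVWX ▸ hfin
  obtain ⟨V, rfl⟩ := (hVWfin.subset Set.subset_union_left).exists_finset_coe
  obtain ⟨W, rfl⟩ := (hVWfin.subset Set.subset_union_right).exists_finset_coe
  rw [Set.ncard_coe_finset] at hWd
  rw [disjoint_coe] at hVW
  have hX : ((V ∪ W : Finset α) : Set α) = H.vertexSet := by rw [coe_union, hVWX]
  have hXc : (V ∪ W).card = n := by rw [← hn, ← hX, Set.ncard_coe_finset]
  have hdeg' : ∀ v ∈ V ∪ W,
      (missingPairs H.finsetEdges (V ∪ W) v).card < (n - d) * (n - d - 1) := by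
    intro v hv
    rw [← hXc] at hdeg ⊢
    exact card_missingPairs_lt hH hX hdeg hv
  rcases le_total (100 * d) n with hsmall | hlarge
  · obtain ⟨M, hM, rfl⟩ := exists_matching_of_small H.finsetEdges d (V ∪ W) (by omega)
      (by rwa [hXc])
    exact hM.hasMatchingOfSize
  set Z := (powersetCard 3 (V ∪ W)).filter fun e : Finset α =>
    (e : Set α) ∈ (extremal (V : Set α) W).edgeSet \ H.edgeSet with hZ
  have hZc : 10 ^ 12 * Z.card ≤ n ^ 3 := by
    have h1 : (Z.card : ℝ) ≤ 1 / 10 ^ 12 * (n : ℝ) ^ 3 :=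
      le_trans (by exact_mod_cast card_filter_missing_le (V ∪ W) hVWfin) hmiss
    have h2 : (10 ^ 12 * Z.card : ℝ) ≤ (n : ℝ) ^ 3 := by linarith
    exact_mod_cast h2
  have hZ3 : ∀ e ∈ Z, e.card = 3 := fun e he => (mem_powersetCard.1 (mem_filter.1 he).1).2
  have hbound : ∀ {A : Finset α} {P : α → Finset (α × α)},
      (∀ v ∈ A, ∀ p ∈ P v, {v, p.1, p.2} ∉ H.finsetEdges → {v, p.1, p.2} ∈ Z) →
      10 ^ 12 * ∑ v ∈ A, (missingIn H.finsetEdges (P v) v).card ≤ 27 * n ^ 3 := fun hP =>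
    (Nat.mul_le_mul_left _ (sum_card_missingIn_le hZ3 hP)).trans (by omega)
  have hne : ∀ {v w}, v ∈ V → w ∈ W → v ≠ w := fun hv hw h =>
    disjoint_left.1 hVW hv (h ▸ hw)
  obtain ⟨M, hM, rfl⟩ := exists_matching_of_close hVW hXc hn₀ hWd hd hlarge hdeg'
    (hbound fun v hv p hp hF => by
      simp only [mem_product, mem_erase] at hp
      refine mem_filter.2 ⟨mem_powersetCard.2 ⟨by simp [insert_subset_iff, *],
        card_triple hp.1.1.symm (hne hv hp.2) (hne hp.1.2 hp.2)⟩, Or.inl ?_, hF⟩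
      exact ⟨v, hv, p.1, hp.1.2, p.2, hp.2, hp.1.1.symm, hne hv hp.2, hne hp.1.2 hp.2,
        by push_cast; rfl⟩)
    (hbound fun w hw p hp hF => by
      simp only [mem_offDiag] at hp
      refine mem_filter.2 ⟨mem_powersetCard.2 ⟨by simp [insert_subset_iff, *],
        card_triple (hne hp.1 hw).symm (hne hp.2.1 hw).symm hp.2.2⟩, Or.inl ?_, hF⟩
      exact ⟨p.1, hp.1, p.2, hp.2.1, w, hw, hp.2.2, hne hp.1 hw, hne hp.2.1 hw,
        by push_cast; rw [Set.insert_comm, Set.pair_comm]⟩)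
    (hbound fun v hv p hp hF => by
      simp only [mem_offDiag] at hp
      refine mem_filter.2 ⟨mem_powersetCard.2 ⟨by simp [insert_subset_iff, *],
        card_triple (hne hv hp.1) (hne hv hp.2.1) hp.2.2⟩, Or.inr ?_, hF⟩
      exact ⟨v, hv, p.1, hp.1, p.2, hp.2.1, hne hv hp.1, hne hv hp.2.1, hp.2.2,
        by push_cast; rfl⟩)
  exact hM.hasMatchingOfSize

end Hypergraph

theorem lemma4p1 :
    ∃ ε : ℝ, 0 < ε ∧ ∃ n₀ : ℕ,
      ∀ (α : Type*) (H : Hypergraph α) (n d : ℕ),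
        H.IsThreeUniform →
        H.vertexSet.Finite → H.vertexSet.ncard = n → n₀ ≤ n →
        (d : ℝ) ≤ (n : ℝ) / 3 →
        ((n - 1).choose 2 : ℤ) - ((n - d).choose 2 : ℤ) < (H.minVertexDegree : ℤ) →
        H.IsCloseToExtremal ε d →
        H.HasMatchingOfSize d := by
  -- With this ε, each sum of missing pairs is at most 27n³/10¹². The threshold n²/10⁶ then leaves
  -- at most 27n/10⁶ atypical vertices per side, yet three times it stays below about (n/200)², as
  -- switching requires.
  refine ⟨1 / 10 ^ 12, by positivity, 10 ^ 6, fun α H n d hH hfin hn hn₀ hd hdeg hclose => ?_⟩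
  have hd' : (3 * d : ℝ) ≤ n := by linarith
  exact Hypergraph.hasMatchingOfSize_of_isCloseToExtremal H hH hfin hn hn₀ (by exact_mod_cast hd')
    hdeg hclose
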